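/- Let $n\ge 0$. For $u\in L^1_{loc}(\mathbb R^n)$ (complex-valued) put $N_1(u)=\limsup_{R\to+\infty}R^{-n}\int_{C_R}|u(x)|\,dx$, where $C_R=\{x\in\mathbb R^n:\max_j|x_j|\le R/2\}$. Let $B^1(\mathbb R^n)=\{u\in L^1_{loc}(\mathbb R^n): N_1(u)<+\infty\}$ and $B^1_0(\mathbb R^n)=\{u\in L^1_{loc}(\mathbb R^n): N_1(u)=0\}$. The Besicovitch space $\mathfrak B^1(\mathbb R^n)$ is the closure, for the norm induced by $N_1$, of the classes of the trigonometric polynomials $\sum a_\lambda e^{2\pi i\lambda\cdot x}$ (finite sums, $\lambda\in\mathbb R^n$) in the quotient space $B^1(\mathbb R^n)/B^1_0(\mathbb R^n)$. Let $AP(\mathbb R^n)$ be the algebra of Bohr almost periodic functions (the uniform limits of trigonometric polynomials), and let $\mathfrak B_n$ be the Bohr compactification of $\mathbb R^n$, that is, the spectrum of the commutative $C^*$-algebra $AP(\mathbb R^n)$, a compact abelian group with normalized Haar measure $m$. The Gelfand transform $f\mapsto\hat f$ from $AP(\mathbb R^n)$ to $C(\mathfrak B_n)$ satisfies $\int_{\mathfrak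 B_n}|\hat f|\,dm=N_1(f)$ and so extends by continuity to a linear isometry $u\mapsto\hat u$ from $\mathfrak B^1(\mathbb R^n)$ into $L^1(\mathfrak B_n,m)$. Let $u\in\mathfrak B^1(\mathbb R^n)$. Then $u\in\mathfrak B^1(\mathbb R^n)\cap L^\infty(\mathbb R^n)$ (that is, the class $u$ has a representative $v\in L^\infty(\mathbb R^n)$) if and only if $\hat u\in L^\infty(\mathfrak B_n,m)$. Moreover, $$\|\hat u\|_{\infty}=\inf\{\,\|v\|_\infty : v\in L^\infty(\mathbb R^n),\ v=u\ \text{in}\ \mathfrak B^1(\mathbb R^n)\,\},$$ with both sides equal to $+\infty$ if $\hat u\notin L^\infty(\mathfrak B_n,m)$. If the class $u$ has a real-valued representative, then both assertions also hold with $v$ restricted to real-valued functions. -/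

import Mathlib

open MeasureTheory Filter Topology BoundedContinuousFunction
open scoped ENNReal

noncomputable section

/-- The exponential `x ↦ e^{2πi λ·x}`. -/
def expo (n : ℕ) (l : Fin n → ℝ) : (Fin n → ℝ) →ᵇ ℂ :=
  BoundedContinuousFunction.ofNormedAddCommGroup
    (fun x => Complex.exp (2 * Real.pi * Complex.I * ((l ⬝ᵥ x : ℝ) : ℂ)))
    (by unfold dotProduct; fun_prop) 1
    (fun x => by
      have h : (2 * Real.pi * Complex.I * ((l ⬝ᵥ x : ℝ) : ℂ)) =
        ((2 * Real.pi * (l ⬝ᵥ x) : ℝ) : ℂ) * Complex.I := by push_cast; ring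
      rw [h, Complex.norm_exp_ofReal_mul_I])

theorem expo_apply (n : ℕ) (l x : Fin n → ℝ) :
    expo n l x = Complex.exp (2 * Real.pi * Complex.I * ((l ⬝ᵥ x : ℝ) : ℂ)) := rfl

theorem expo_zero (n : ℕ) : expo n 0 = 1 := by
  ext x; simp [expo_apply]

theorem expo_add (n : ℕ) (l k : Fin n → ℝ) : expo n (l + k) = expo n l * expo n k := by
  ext x
  simp only [expo_apply, BoundedContinuousFunction.coe_mul, Pi.mul_apply, add_dotProduct,
    ← Complex.exp_add]
  congr 1; push_cast; ring

theorem expo_neg (n : ℕ) (l : Fin n → ℝ) : expo n (-l) = star (expo n l) := by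
  ext x
  simp only [expo_apply, BoundedContinuousFunction.star_apply, neg_dotProduct, RCLike.star_def,
    ← Complex.exp_conj]
  congr 1
  rw [map_mul, map_mul, map_mul, Complex.conj_I, Complex.conj_ofReal, Complex.conj_ofReal,
    Complex.conj_ofNat]
  push_cast; ring

/-- The algebra of trigonometric polynomials `∑ a_λ e^{2πi λ·x}` (finite sums) on `ℝⁿ`. -/
def trigPoly (n : ℕ) : StarSubalgebra ℂ ((Fin n → ℝ) →ᵇ ℂ) where
  toSubalgebra := (Submodule.span ℂ (Set.range (expo n))).toSubalgebra
    (by rw [← expo_zero]; exact Submodule.subset_span ⟨0, rfl⟩)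
    (fun x y hx hy => by
      have h := Submodule.mul_mem_mul hx hy
      rw [Submodule.span_mul_span] at h
      refine Submodule.span_mono ?_ h
      rintro _ ⟨_, ⟨l, rfl⟩, _, ⟨k, rfl⟩, rfl⟩
      exact ⟨l + k, expo_add n l k⟩)
  star_mem' := fun {f} hf => by
    change star f ∈ Submodule.span ℂ (Set.range (expo n))
    change f ∈ Submodule.span ℂ (Set.range (expo n)) at hf
    induction hf using Submodule.span_induction with
    | mem x h =>
      obtain ⟨l, rfl⟩ := h
      exact Submodule.subset_span ⟨-l, expo_neg n l⟩
    | zero => rw [star_zero]; exact Submodule.zero_mem _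
    | add x y _ _ hx hy => rw [star_add]; exact Submodule.add_mem _ hx hy
    | smul a x _ hx => rw [star_smul]; exact Submodule.smul_mem _ _ hx

theorem mem_trigPoly {n : ℕ} {f : (Fin n → ℝ) →ᵇ ℂ} :
    f ∈ trigPoly n ↔ f ∈ Submodule.span ℂ (Set.range (expo n)) := Iff.rfl

/-- Bohr almost periodic functions on `ℝⁿ`: the uniform limits of trigonometric polynomials. -/
def bohrAP (n : ℕ) : StarSubalgebra ℂ ((Fin n → ℝ) →ᵇ ℂ) := (trigPoly n).topologicalClosure

instance (n : ℕ) : IsClosed (bohrAP n : Set ((Fin n → ℝ) →ᵇ ℂ)) :=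
  (trigPoly n).isClosed_topologicalClosure

/-- The commutative C⋆-algebra `AP(ℝⁿ)`. -/
abbrev AP (n : ℕ) : Type := bohrAP n

theorem trigPoly_le (n : ℕ) : trigPoly n ≤ bohrAP n := (trigPoly n).le_topologicalClosure

instance (n : ℕ) : Nontrivial (AP n) :=
  ⟨⟨0, 1, fun h => by
    have := congrArg (fun f : AP n => f.1 0) h
    simp at this⟩⟩

/-- The exponential as an element of `AP(ℝⁿ)`. -/
def expAP (n : ℕ) (l : Fin n → ℝ) : AP n :=
  ⟨expo n l, trigPoly_le n (Submodule.subset_span ⟨l, rfl⟩)⟩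
theorem bohrAP_le {n : ℕ} {S : Submodule ℂ ((Fin n → ℝ) →ᵇ ℂ)} (hS : IsClosed (S : Set ((Fin n → ℝ) →ᵇ ℂ)))
    (h : ∀ l, expo n l ∈ S) {f : (Fin n → ℝ) →ᵇ ℂ} (hf : f ∈ bohrAP n) : f ∈ S := by
  have h1 : (trigPoly n : Set ((Fin n → ℝ) →ᵇ ℂ)) ⊆ S := fun g hg =>
    (Submodule.span_le (p := S)).2 (by rintro _ ⟨l, rfl⟩; exact h l) hg
  exact closure_minimal h1 hS hf

/-- A closed linear subspace of `AP(ℝⁿ)` that contains all exponentials is everything. -/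
theorem AP_induction {n : ℕ} (S : Submodule ℂ (AP n)) (hS : IsClosed (S : Set (AP n)))
    (h : ∀ l, expAP n l ∈ S) (f : AP n) : f ∈ S := by
  have hc : IsClosed ((S.map (bohrAP n).toSubalgebra.toSubmodule.subtype : Submodule ℂ _) :
      Set ((Fin n → ℝ) →ᵇ ℂ)) := by
    rw [Submodule.map_coe]
    exact ((trigPoly n).isClosed_topologicalClosure.isClosedEmbedding_subtypeVal).isClosedMap _ hS
  obtain ⟨g, hg, hgf⟩ := bohrAP_le hc (fun l => ⟨expAP n l, h l, rfl⟩) f.2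
  have : g = f := Subtype.ext hgf
  exact this ▸ hg

theorem AP_ext {n : ℕ} {f g : AP n} (h : ∀ x, f.1 x = g.1 x) : f = g :=
  Subtype.ext (BoundedContinuousFunction.ext h)

/-- Composition with a continuous map `a : ℝⁿ → ℝⁿ` that preserves almost periodicity. -/
def pullAP {n : ℕ} (a : C(Fin n → ℝ, Fin n → ℝ))
    (ha : ∀ l, (expo n l).compContinuous a ∈ bohrAP n) : AP n →ₐ[ℂ] AP n where
  toFun f := ⟨f.1.compContinuous a, by
    refine bohrAP_le (S := (bohrAP n).toSubalgebra.toSubmodule.comap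
      (BoundedContinuousFunction.compContinuousCLM ℂ ℂ a).toLinearMap) ?_ ha f.2
    exact (trigPoly n).isClosed_topologicalClosure.preimage
      (BoundedContinuousFunction.compContinuousCLM ℂ ℂ a).continuous⟩
  map_one' := rfl
  map_mul' _ _ := rfl
  map_zero' := rfl
  map_add' _ _ := rfl
  commutes' _ := rfl

/-- The translation `f ↦ f(· + y)` on `AP(ℝⁿ)`. -/
def transAP {n : ℕ} (y : Fin n → ℝ) : AP n →ₐ[ℂ] AP n :=
  pullAP ⟨fun x => x + y, by fun_prop⟩ (fun l => by
    have h : (expo n l).compContinuous ⟨fun x => x + y, by fun_prop⟩ =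
        expo n l y • expo n l := by
      ext x
      simp only [compContinuous_apply, ContinuousMap.coe_mk, BoundedContinuousFunction.coe_smul,
        expo_apply, smul_eq_mul, dotProduct_add, ← Complex.exp_add]
      congr 1; push_cast; ring
    rw [h]
    exact (bohrAP n).toSubalgebra.toSubmodule.smul_mem _ (expAP n l).2)

/-- The reflection `f ↦ f(-·)` on `AP(ℝⁿ)`. -/
def reflAP (n : ℕ) : AP n →ₐ[ℂ] AP n :=
  pullAP ⟨fun x => -x, by fun_prop⟩ (fun l => by
    have h : (expo n l).compContinuous ⟨fun x => -x, by fun_prop⟩ = expo n (-l) := by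
      ext x
      simp only [compContinuous_apply, ContinuousMap.coe_mk, expo_apply, neg_dotProduct,
        dotProduct_neg]
    rw [h]
    exact (expAP n (-l)).2)

theorem transAP_apply {n : ℕ} (y : Fin n → ℝ) (f : AP n) (x : Fin n → ℝ) :
    (transAP y f).1 x = f.1 (x + y) := rfl

theorem reflAP_apply {n : ℕ} (f : AP n) (x : Fin n → ℝ) : (reflAP n f).1 x = f.1 (-x) := rfl

theorem transAP_exp {n : ℕ} (y l : Fin n → ℝ) :
    transAP y (expAP n l) = expo n l y • expAP n l := by
  apply AP_ext; intro x
  rw [transAP_apply]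
  change expo n l (x + y) = expo n l y * expo n l x
  simp only [expo_apply, dotProduct_add, ← Complex.exp_add]
  congr 1; push_cast; ring

theorem reflAP_exp {n : ℕ} (l : Fin n → ℝ) : reflAP n (expAP n l) = star (expAP n l) := by
  apply AP_ext; intro x
  change expo n l (-x) = star (expo n l) x
  rw [← expo_neg]
  simp only [expo_apply, neg_dotProduct, dotProduct_neg]

theorem norm_transAP_le {n : ℕ} (y : Fin n → ℝ) (f : AP n) : ‖transAP y f‖ ≤ ‖f‖ :=
  norm_compContinuous_le f.1 _

/-- The Bohr compactification of `ℝⁿ`: the spectrum (character space, with the weak-* topology)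
of the C⋆-algebra `AP(ℝⁿ)`. -/
def Bohr (n : ℕ) : Type := WeakDual.characterSpace ℂ (AP n)

namespace Bohr

variable {n : ℕ}

instance : TopologicalSpace (Bohr n) :=
  inferInstanceAs (TopologicalSpace (WeakDual.characterSpace ℂ (AP n)))

instance : CompactSpace (Bohr n) :=
  inferInstanceAs (CompactSpace (WeakDual.characterSpace ℂ (AP n)))

instance : T2Space (Bohr n) :=
  inferInstanceAs (T2Space (WeakDual.characterSpace ℂ (AP n)))

instance : MeasurableSpace (Bohr n) := borel _

instance : BorelSpace (Bohr n) := ⟨rfl⟩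

/-- A point of the Bohr compactification, as a unital algebra homomorphism `AP(ℝⁿ) → ℂ`. -/
def hom (p : Bohr n) : AP n →ₐ[ℂ] ℂ := WeakDual.CharacterSpace.equivAlgHom p

/-- The point of the Bohr compactification given by a unital algebra homomorphism. -/
def ofHom (p : AP n →ₐ[ℂ] ℂ) : Bohr n := WeakDual.CharacterSpace.equivAlgHom.symm p

@[simp] theorem hom_ofHom (p : AP n →ₐ[ℂ] ℂ) : (ofHom p).hom = p :=
  WeakDual.CharacterSpace.equivAlgHom.apply_symm_apply p

theorem continuous_hom (p : Bohr n) : Continuous p.hom :=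
  WeakDual.CharacterSpace.toCLM (𝕜 := ℂ) (A := AP n) p |>.continuous

theorem hom_star (p : Bohr n) (f : AP n) : p.hom (star f) = star (p.hom f) :=
  map_star (F := WeakDual.characterSpace ℂ (AP n)) p f

theorem norm_hom_le (p : Bohr n) (f : AP n) : ‖p.hom f‖ ≤ ‖f‖ :=
  AlgHom.norm_apply_le_self p.hom f

theorem ext_exp {p q : Bohr n} (h : ∀ l, p.hom (expAP n l) = q.hom (expAP n l)) : p = q := by
  apply WeakDual.CharacterSpace.equivAlgHom.injective
  apply AlgHom.ext
  intro f
  exact AP_induction (LinearMap.eqLocus p.hom.toLinearMap q.hom.toLinearMap)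
    (isClosed_eq p.continuous_hom q.continuous_hom) h f

theorem exists_conv (p : Bohr n) (f : AP n) :
    ∃ g : AP n, ∀ x, g.1 x = p.hom (transAP x f) := by
  let S : Submodule ℂ (AP n) :=
    { carrier := {f | ∃ g : AP n, ∀ x, g.1 x = p.hom (transAP x f)}
      add_mem' := by
        rintro a b ⟨g, hg⟩ ⟨k, hk⟩
        refine ⟨g + k, fun x => ?_⟩
        rw [map_add, map_add, ← hg, ← hk]; rfl
      zero_mem' := ⟨0, fun x => by rw [map_zero, map_zero]; rfl⟩
      smul_mem' := by
        rintro c a ⟨g, hg⟩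
        refine ⟨c • g, fun x => ?_⟩
        rw [map_smul, map_smul, ← hg]; rfl }
  refine AP_induction S ?_ (fun l => ?_) f
  · refine IsSeqClosed.isClosed ?_
    intro u f hu hf
    choose g hg using hu
    have hd : ∀ i j, dist (g i) (g j) ≤ dist (u i) (u j) := by
      intro i j
      rw [dist_eq_norm, dist_eq_norm]
      change ‖(g i - g j).1‖ ≤ _
      rw [BoundedContinuousFunction.norm_le (norm_nonneg _)]
      intro x
      have : (g i - g j).1 x = p.hom (transAP x (u i - u j)) := by
        rw [map_sub, map_sub, ← hg, ← hg]; rfl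
      rw [this]
      exact (p.norm_hom_le _).trans (norm_transAP_le _ _)
    have hc : CauchySeq g := by
      rw [Metric.cauchySeq_iff]
      intro ε hε
      obtain ⟨N, hN⟩ := Metric.cauchySeq_iff.1 hf.cauchySeq ε hε
      exact ⟨N, fun i hi j hj => (hd i j).trans_lt (hN i hi j hj)⟩
    obtain ⟨k, hk⟩ := cauchySeq_tendsto_of_complete hc
    refine ⟨k, fun x => ?_⟩
    have h1 : Tendsto (fun i => (g i).1 x) atTop (𝓝 (k.1 x)) :=
      ((BoundedContinuousFunction.evalCLM ℂ x).continuous.comp continuous_subtype_val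
        |>.tendsto k).comp hk
    have hT : Continuous (transAP x : AP n → AP n) :=
      AddMonoidHomClass.continuous_of_bound (transAP x) 1
        (fun f => by rw [one_mul]; exact norm_transAP_le x f)
    have h2 : Tendsto (fun i => p.hom (transAP x (u i))) atTop (𝓝 (p.hom (transAP x f))) :=
      ((p.continuous_hom.comp hT).tendsto f).comp hf
    simp only [hg] at h1
    exact tendsto_nhds_unique h1 h2
  · refine ⟨p.hom (expAP n l) • expAP n l, fun x => ?_⟩
    rw [transAP_exp, map_smul, smul_eq_mul, mul_comm]; rfl

/-- For a point `p` of the Bohr compactification and `f ∈ AP(ℝⁿ)`, the almost periodic function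
`x ↦ p (f(· + x))`. -/
def conv (p : Bohr n) : AP n →ₐ[ℂ] AP n where
  toFun f := (exists_conv p f).choose
  map_one' := AP_ext fun x => by rw [(exists_conv p 1).choose_spec, map_one, map_one]; rfl
  map_mul' f g := AP_ext fun x => by
    rw [(exists_conv p (f * g)).choose_spec, map_mul, map_mul, ← (exists_conv p f).choose_spec,
      ← (exists_conv p g).choose_spec]; rfl
  map_zero' := AP_ext fun x => by rw [(exists_conv p 0).choose_spec, map_zero, map_zero]; rfl
  map_add' f g := AP_ext fun x => by
    rw [(exists_conv p (f + g)).choose_spec, map_add, map_add, ← (exists_conv p f).choose_spec,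
      ← (exists_conv p g).choose_spec]; rfl
  commutes' c := AP_ext fun x => by
    rw [(exists_conv p _).choose_spec, AlgHom.commutes, AlgHom.commutes]; rfl

theorem conv_apply (p : Bohr n) (f : AP n) (x : Fin n → ℝ) :
    (p.conv f).1 x = p.hom (transAP x f) := (exists_conv p f).choose_spec x

theorem conv_exp (p : Bohr n) (l : Fin n → ℝ) :
    p.conv (expAP n l) = p.hom (expAP n l) • expAP n l := AP_ext fun x => by
  rw [conv_apply, transAP_exp, map_smul, smul_eq_mul, mul_comm]; rfl

/-- The canonical map `in : ℝⁿ → 𝔅ₙ`, sending `x` to the evaluation at `x`. -/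
def emb (x : Fin n → ℝ) : Bohr n := ofHom
  { toFun := fun f => f.1 x
    map_one' := rfl
    map_mul' := fun _ _ => rfl
    map_zero' := rfl
    map_add' := fun _ _ => rfl
    commutes' := fun _ => rfl }

theorem hom_emb (x : Fin n → ℝ) (f : AP n) : (emb x).hom f = f.1 x := by
  rw [emb, hom_ofHom]; rfl

/-- The group law of the Bohr compactification: `(p + q)(f) = p (x ↦ q (f(· + x)))`. -/
instance : Add (Bohr n) := ⟨fun p q => ofHom (p.hom.comp q.conv)⟩

instance : Zero (Bohr n) := ⟨emb 0⟩

/-- The inverse: `(-p)(f) = p (f(-·))`. -/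
instance : Neg (Bohr n) := ⟨fun p => ofHom (p.hom.comp (reflAP n))⟩

theorem hom_add (p q : Bohr n) (f : AP n) : (p + q).hom f = p.hom (q.conv f) := by
  change (ofHom _).hom f = _
  rw [hom_ofHom]; rfl

theorem hom_neg (p : Bohr n) (f : AP n) : (-p).hom f = p.hom (reflAP n f) := by
  change (ofHom _).hom f = _
  rw [hom_ofHom]; rfl

theorem add_exp (p q : Bohr n) (l : Fin n → ℝ) :
    (p + q).hom (expAP n l) = p.hom (expAP n l) * q.hom (expAP n l) := by
  rw [hom_add, conv_exp, map_smul, smul_eq_mul, mul_comm]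

theorem zero_exp (l : Fin n → ℝ) : (0 : Bohr n).hom (expAP n l) = 1 := by
  change (emb 0).hom _ = 1
  rw [hom_emb]
  change expo n l 0 = 1
  simp [expo_apply]

theorem neg_exp (p : Bohr n) (l : Fin n → ℝ) :
    (-p).hom (expAP n l) = star (p.hom (expAP n l)) := by
  rw [hom_neg, reflAP_exp, hom_star]

theorem star_mul_exp (p : Bohr n) (l : Fin n → ℝ) :
    star (p.hom (expAP n l)) * p.hom (expAP n l) = 1 := by
  rw [← hom_star, ← map_mul]
  have : star (expAP n l) * expAP n l = 1 := AP_ext fun x => by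
    change (star (expo n l) * expo n l) x = 1
    rw [← expo_neg, ← expo_add, neg_add_cancel, expo_zero]; rfl
  rw [this, map_one]

instance : AddCommGroup (Bohr n) where
  add_assoc p q r := ext_exp fun l => by simp only [add_exp, mul_assoc]
  zero_add p := ext_exp fun l => by rw [add_exp, zero_exp, one_mul]
  add_zero p := ext_exp fun l => by rw [add_exp, zero_exp, mul_one]
  neg_add_cancel p := ext_exp fun l => by rw [add_exp, neg_exp, zero_exp, star_mul_exp]
  add_comm p q := ext_exp fun l => by rw [add_exp, add_exp, mul_comm]
  nsmul := nsmulRec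
  zsmul := zsmulRec

theorem emb_add (x y : Fin n → ℝ) : emb (x + y) = emb x + emb y := ext_exp fun l => by
  rw [add_exp, hom_emb, hom_emb, hom_emb]
  change expo n l (x + y) = expo n l x * expo n l y
  simp only [expo_apply, dotProduct_add, ← Complex.exp_add]
  congr 1; push_cast; ring

theorem continuous_eval (f : AP n) : Continuous fun p : Bohr n => p.hom f :=
  (WeakDual.gelfandTransform ℂ (AP n) f).continuous

theorem isClosedEmbedding_exp :
    IsClosedEmbedding fun (p : Bohr n) (l : Fin n → ℝ) => p.hom (expAP n l) :=
  (continuous_pi fun l => continuous_eval (expAP n l)).isClosedEmbedding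
    fun _ _ h => ext_exp fun l => congrFun h l

instance : IsTopologicalAddGroup (Bohr n) where
  continuous_add := by
    rw [isClosedEmbedding_exp.isInducing.continuous_iff]
    refine continuous_pi fun l => ?_
    simp only [Function.comp_def, add_exp]
    exact ((continuous_eval _).comp continuous_fst).mul ((continuous_eval _).comp continuous_snd)
  continuous_neg := by
    rw [isClosedEmbedding_exp.isInducing.continuous_iff]
    refine continuous_pi fun l => ?_
    simp only [Function.comp_def, neg_exp]
    exact (continuous_eval _).star

/-- The Haar measure on the Bohr compactification, normalized to total mass one. -/
def haar (n : ℕ) : Measure (Bohr n) := Measure.addHaarMeasure ⊤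

instance : IsProbabilityMeasure (haar n) := ⟨Measure.addHaarMeasure_self (K₀ := ⊤)⟩

instance : (haar n).IsAddHaarMeasure := Measure.isAddHaarMeasure_addHaarMeasure _

instance : (haar n).Regular := Measure.regular_addHaarMeasure

end Bohr

/-- The Gelfand transform `f ↦ f̂` from `AP(ℝⁿ)` to the continuous functions on the Bohr
compactification, `f̂(p) = p(f)`. -/
def gelfand (n : ℕ) : AP n →ₐ[ℂ] C(Bohr n, ℂ) := WeakDual.gelfandTransform ℂ (AP n)

theorem gelfand_apply {n : ℕ} (f : AP n) (p : Bohr n) : gelfand n f p = p.hom f := rfl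

theorem gelfand_emb {n : ℕ} (f : AP n) (x : Fin n → ℝ) : gelfand n f (Bohr.emb x) = f.1 x :=
  Bohr.hom_emb x f

/-- The cube `C_R = {x : |x|_∞ ≤ R / 2}`. -/
def cube (n : ℕ) (R : ℝ) : Set (Fin n → ℝ) := {x | ∀ j, |x j| ≤ R / 2}

theorem cube_eq (n : ℕ) (R : ℝ) : cube n R = Set.pi Set.univ fun _ => Set.Icc (-(R / 2)) (R / 2) := by
  ext x; simp only [cube, abs_le, Set.mem_ofPred_eq, Set.mem_univ_pi, Set.mem_Icc]

theorem measurableSet_cube (n : ℕ) (R : ℝ) : MeasurableSet (cube n R) := by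
  rw [cube_eq]; exact MeasurableSet.univ_pi fun _ => measurableSet_Icc

theorem isCompact_cube (n : ℕ) (R : ℝ) : IsCompact (cube n R) := by
  rw [cube_eq]; exact isCompact_univ_pi fun _ => isCompact_Icc

theorem volume_cube (n : ℕ) {R : ℝ} (hR : 0 < R) : volume (cube n R) = ENNReal.ofReal (R ^ n) := by
  rw [cube_eq, volume_pi_pi]
  simp only [Real.volume_Icc, sub_neg_eq_add, add_halves, Finset.prod_const, Finset.card_univ,
    Fintype.card_fin]
  rw [ENNReal.ofReal_pow hR.le]

/-- The mean `L¹`-norm `N₁(u) = limsup_{R → +∞} R⁻ⁿ ∫_{C_R} |u(x)| dx`. -/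
def meanNorm (n : ℕ) (u : (Fin n → ℝ) → ℂ) : ℝ≥0∞ :=
  limsup (fun R : ℝ => ENNReal.ofReal (R ^ n)⁻¹ * ∫⁻ x in cube n R, ‖u x‖ₑ) atTop

theorem meanNorm_zero (n : ℕ) : meanNorm n 0 = 0 := by
  simp [meanNorm]

theorem limsup_add_le_ennreal (f g : ℝ → ℝ≥0∞) :
    limsup (fun R => f R + g R) atTop ≤ limsup f atTop + limsup g atTop := by
  refine ENNReal.le_of_forall_pos_le_add fun ε hε hlt => ?_
  have hε' : ((ε / 2 : NNReal) : ℝ≥0∞) ≠ 0 := by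
    rw [ENNReal.coe_ne_zero]; exact (half_pos hε).ne'
  have hf := eventually_lt_of_limsup_lt (ENNReal.lt_add_right (ENNReal.add_lt_top.1 hlt).1.ne hε')
  have hg := eventually_lt_of_limsup_lt (ENNReal.lt_add_right (ENNReal.add_lt_top.1 hlt).2.ne hε')
  refine limsup_le_of_le (by isBoundedDefault) ?_
  filter_upwards [hf, hg] with R h1 h2
  refine (add_le_add h1.le h2.le).trans (le_of_eq ?_)
  rw [add_add_add_comm, ← ENNReal.coe_add, add_halves]

theorem meanNorm_add_le (n : ℕ) {u v : (Fin n → ℝ) → ℂ} (hu : AEStronglyMeasurable u volume) :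
    meanNorm n (u + v) ≤ meanNorm n u + meanNorm n v := by
  refine le_trans ?_ (limsup_add_le_ennreal _ _)
  refine limsup_le_limsup (Eventually.of_forall fun R => ?_)
  simp only [Pi.add_apply]
  rw [← mul_add, ← lintegral_add_left' hu.restrict.enorm]
  gcongr
  exact enorm_add_le _ _

theorem meanNorm_smul (n : ℕ) (c : ℂ) (u : (Fin n → ℝ) → ℂ) :
    meanNorm n (c • u) = ‖c‖ₑ * meanNorm n u := by
  unfold meanNorm
  rw [← ENNReal.limsup_const_mul_of_ne_top enorm_ne_top]
  congr 1; ext R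
  simp only [Pi.smul_apply, enorm_smul]
  rw [lintegral_const_mul' _ _ enorm_ne_top, mul_left_comm]

theorem meanNorm_le_of_bound (n : ℕ) {u : (Fin n → ℝ) → ℂ} {M : ℝ≥0∞} (h : ∀ x, ‖u x‖ₑ ≤ M) :
    meanNorm n u ≤ M := by
  refine limsup_le_of_le (by isBoundedDefault) ?_
  filter_upwards [eventually_gt_atTop 0] with R hR
  calc ENNReal.ofReal (R ^ n)⁻¹ * ∫⁻ x in cube n R, ‖u x‖ₑ
      ≤ ENNReal.ofReal (R ^ n)⁻¹ * ∫⁻ _ in cube n R, M := by gcongr; exact h _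
    _ = (ENNReal.ofReal (R ^ n)⁻¹ * ENNReal.ofReal (R ^ n)) * M := by
      rw [lintegral_const, Measure.restrict_apply_univ, volume_cube n hR]; ring
    _ = M := by
      rw [← ENNReal.ofReal_mul (by positivity), inv_mul_cancel₀ (by positivity)]; simp

/-- The functions `u ∈ L¹_loc(ℝⁿ)` with `N₁(u) < +∞`. -/
def besFun (n : ℕ) : Submodule ℂ ((Fin n → ℝ) → ℂ) where
  carrier := {u | LocallyIntegrable u volume ∧ meanNorm n u < ∞}
  add_mem' hu hv := ⟨hu.1.add hv.1,
    (meanNorm_add_le n hu.1.aestronglyMeasurable).trans_lt (ENNReal.add_lt_top.2 ⟨hu.2, hv.2⟩)⟩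
  zero_mem' := ⟨locallyIntegrable_zero, by rw [meanNorm_zero]; exact ENNReal.zero_lt_top⟩
  smul_mem' c u hu := ⟨hu.1.smul c, by
    rw [meanNorm_smul]; exact ENNReal.mul_lt_top enorm_lt_top hu.2⟩

/-- The space `B¹(ℝⁿ)` of functions `u ∈ L¹_loc(ℝⁿ)` with `N₁(u) < +∞`, with the seminorm `N₁`. -/
def B1 (n : ℕ) : Type := besFun n

namespace B1

variable {n : ℕ}

instance : AddCommGroup (B1 n) := inferInstanceAs (AddCommGroup (besFun n))

instance : Module ℂ (B1 n) := inferInstanceAs (Module ℂ (besFun n))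

instance : CoeFun (B1 n) fun _ => (Fin n → ℝ) → ℂ := ⟨fun u => u.1⟩

theorem locallyIntegrable (u : B1 n) : LocallyIntegrable u volume := u.2.1

instance : Norm (B1 n) := ⟨fun u => (meanNorm n u).toReal⟩

theorem norm_def (u : B1 n) : ‖u‖ = (meanNorm n u).toReal := rfl

theorem ofReal_norm (u : B1 n) : ENNReal.ofReal ‖u‖ = meanNorm n u :=
  ENNReal.ofReal_toReal u.2.2.ne

instance : SeminormedAddCommGroup (B1 n) :=
  AddGroupSeminorm.toSeminormedAddCommGroup
    { toFun := fun u : B1 n => ‖u‖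
      map_zero' := by
        change (meanNorm n 0).toReal = 0
        rw [meanNorm_zero]; rfl
      add_le' := fun u v => by
        rw [norm_def, norm_def, norm_def, ← ENNReal.toReal_add u.2.2.ne v.2.2.ne]
        exact ENNReal.toReal_mono (ENNReal.add_ne_top.2 ⟨u.2.2.ne, v.2.2.ne⟩)
          (meanNorm_add_le n u.locallyIntegrable.aestronglyMeasurable)
      neg' := fun u => by
        rw [norm_def, norm_def]
        congr 1
        change meanNorm n (-u.1) = _
        rw [← neg_one_smul ℂ u.1, meanNorm_smul]; simp }

instance : NormedSpace ℂ (B1 n) where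
  norm_smul_le c u := by
    change (meanNorm n (c • u.1)).toReal ≤ ‖c‖ * (meanNorm n u.1).toReal
    rw [meanNorm_smul, ENNReal.toReal_mul, toReal_enorm]

end B1

/-- Bounded continuous functions belong to `B¹(ℝⁿ)`. -/
def toB1 (n : ℕ) : ((Fin n → ℝ) →ᵇ ℂ) →ₗ[ℂ] B1 n where
  toFun f := ⟨f, f.continuous.locallyIntegrable,
    (meanNorm_le_of_bound n (M := ‖f‖ₑ) fun x => by
      rw [enorm_le_iff_norm_le]; exact f.norm_coe_le_norm x).trans_lt enorm_lt_top⟩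
  map_add' _ _ := rfl
  map_smul' _ _ := rfl

theorem norm_toB1_le {n : ℕ} (f : (Fin n → ℝ) →ᵇ ℂ) : ‖toB1 n f‖ ≤ ‖f‖ := by
  rw [B1.norm_def, ← toReal_enorm f]
  refine ENNReal.toReal_mono enorm_ne_top (meanNorm_le_of_bound n fun x => ?_)
  rw [enorm_le_iff_norm_le]; exact f.norm_coe_le_norm x

/-- The quotient `B¹(ℝⁿ) / B¹₀(ℝⁿ)` by the functions with `N₁(u) = 0`, with the norm `N₁`. -/
abbrev B1Quot (n : ℕ) : Type := SeparationQuotient (B1 n)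

/-- The class of `u ∈ B¹(ℝⁿ)` in `B¹(ℝⁿ) / B¹₀(ℝⁿ)`. -/
def B1.cls {n : ℕ} : B1 n →L[ℂ] B1Quot n := SeparationQuotient.mkCLM ℂ (B1 n)

/-- Two functions have the same class exactly when `N₁(u - v) = 0`. -/
theorem B1.cls_eq_iff {n : ℕ} (u v : B1 n) :
    B1.cls u = B1.cls v ↔ meanNorm n (fun x => u x - v x) = 0 := by
  change SeparationQuotient.mk u = SeparationQuotient.mk v ↔ _
  rw [SeparationQuotient.mk_eq_mk, Metric.inseparable_iff, dist_eq_norm, B1.norm_def,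
    ENNReal.toReal_eq_zero_iff]
  exact or_iff_left (u - v).2.2.ne

/-- The Besicovitch space: the closure of the trigonometric polynomials in
`B¹(ℝⁿ) / B¹₀(ℝⁿ)`. -/
def besicovitch (n : ℕ) : Submodule ℂ (B1Quot n) :=
  ((trigPoly n).toSubalgebra.toSubmodule.map
    (B1.cls.toLinearMap.comp (toB1 n))).topologicalClosure

theorem continuous_cls_toB1 (n : ℕ) : Continuous (B1.cls.toLinearMap.comp (toB1 n)) :=
  AddMonoidHomClass.continuous_of_bound _ 1 fun f => by
    rw [one_mul]; exact norm_toB1_le f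

/-- The canonical map of `AP(ℝⁿ)` into the Besicovitch space. -/
def apToBes (n : ℕ) : AP n →ₗ[ℂ] besicovitch n :=
  ((B1.cls.toLinearMap.comp (toB1 n)).comp (bohrAP n).toSubalgebra.toSubmodule.subtype).codRestrict
    (besicovitch n) fun f => by
      refine bohrAP_le (S := (besicovitch n).comap (B1.cls.toLinearMap.comp (toB1 n))) ?_ ?_ f.2
      · exact (Submodule.isClosed_topologicalClosure _).preimage (continuous_cls_toB1 n)
      · exact fun l => Submodule.le_topologicalClosure _
          ⟨expo n l, Submodule.subset_span ⟨l, rfl⟩, rfl⟩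

theorem norm_apToBes {n : ℕ} (f : AP n) : ‖apToBes n f‖ = (meanNorm n f.1).toReal := rfl

theorem denseRange_apToBes (n : ℕ) : DenseRange (apToBes n) := by
  intro u
  rw [closure_subtype]
  refine closure_mono ?_ u.2
  rintro _ ⟨f, hf, rfl⟩
  exact ⟨_, ⟨⟨f, trigPoly_le n hf⟩, rfl⟩, rfl⟩

/-- The Gelfand transform of an almost periodic function, as an element of `L¹(𝔅ₙ, m)`. -/
def gelfandAP (n : ℕ) : AP n →ₗ[ℂ] Lp ℂ 1 (Bohr.haar n) :=
  (ContinuousMap.toLp (E := ℂ) 1 (Bohr.haar n) ℂ).toLinearMap.comp (gelfand n).toLinearMap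

theorem norm_gelfand_le {n : ℕ} (f : AP n) : ‖gelfand n f‖ ≤ ‖f‖ :=
  (ContinuousMap.norm_le _ (norm_nonneg f)).2 fun p => p.norm_hom_le f

/-- Translation invariance: a non-trivial exponential has zero Haar integral. -/
theorem integral_expAP {n : ℕ} {l : Fin n → ℝ} (hl : l ≠ 0) :
    ∫ p, gelfand n (expAP n l) p ∂Bohr.haar n = 0 := by
  have hll : 0 < l ⬝ᵥ l := by
    have h0 : 0 ≤ l ⬝ᵥ l := Finset.sum_nonneg fun i _ => mul_self_nonneg (l i)
    exact lt_of_le_of_ne h0 fun h => hl (dotProduct_self_eq_zero.1 h.symm)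
  let y : Fin n → ℝ := (1 / (2 * (l ⬝ᵥ l))) • l
  have hy : expo n l y = -1 := by
    rw [expo_apply, dotProduct_smul, smul_eq_mul]
    have : 1 / (2 * (l ⬝ᵥ l)) * (l ⬝ᵥ l) = 1 / 2 := by field_simp
    rw [this, ← Complex.exp_pi_mul_I]
    congr 1; push_cast; ring
  have h := integral_add_left_eq_self (μ := Bohr.haar n) (gelfand n (expAP n l)) (Bohr.emb y)
  simp only [gelfand_apply, Bohr.add_exp, Bohr.hom_emb] at h
  rw [integral_const_mul] at h
  change expo n l y * _ = _ at h
  rw [hy] at h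
  simp only [gelfand_apply]
  have h2 : (2 : ℂ) * ∫ p : Bohr n, p.hom (expAP n l) ∂Bohr.haar n = 0 := by
    linear_combination -h
  simpa using h2

/-- The average over `C_R`. -/
def cubeAvg (n : ℕ) (f : (Fin n → ℝ) → ℂ) (R : ℝ) : ℂ := ((R ^ n)⁻¹ : ℝ) • ∫ x in cube n R, f x

theorem tendsto_cubeAvg_expo {n : ℕ} {l : Fin n → ℝ} (hl : l ≠ 0) :
    Tendsto (cubeAvg n (expo n l)) atTop (𝓝 0) := by
  obtain ⟨j, hj⟩ := Function.ne_iff.1 hl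
  have hj' : l j ≠ 0 := hj
  have key : ∀ R : ℝ, ∫ x in cube n R, expo n l x =
      ∏ i, ∫ t in Set.Icc (-(R / 2)) (R / 2), Complex.exp (2 * Real.pi * Complex.I * (l i * t)) := by
    intro R
    rw [cube_eq, volume_pi, Measure.restrict_pi_pi, ← integral_fintype_prod_eq_prod]
    refine integral_congr_ae (Eventually.of_forall fun x => ?_)
    simp only [expo_apply, ← Complex.exp_sum]
    congr 1
    simp only [dotProduct, Complex.ofReal_sum, Finset.mul_sum, Complex.ofReal_mul]
  have hn : ∀ (a t : ℝ), ‖Complex.exp (2 * Real.pi * Complex.I * (a * t))‖ = 1 := by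
    intro a t
    have : (2 * Real.pi * Complex.I * (a * t) : ℂ) = ((2 * Real.pi * (a * t) : ℝ) : ℂ) * Complex.I := by
      push_cast; ring
    rw [this, Complex.norm_exp_ofReal_mul_I]
  have hb : ∀ R : ℝ, 0 < R → ∀ i, ‖∫ t in Set.Icc (-(R / 2)) (R / 2),
      Complex.exp (2 * Real.pi * Complex.I * (l i * t))‖ ≤ R := by
    intro R hR i
    refine (norm_integral_le_of_norm_le_const (C := 1) (Eventually.of_forall fun t => (hn _ t).le)).trans ?_
    rw [Measure.real, Measure.restrict_apply_univ, Real.volume_Icc, one_mul,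
      ENNReal.toReal_ofReal (by linarith)]
    linarith
  let c : ℂ := 2 * Real.pi * Complex.I * l j
  have hc : c ≠ 0 := by
    simp only [c, ne_eq, mul_eq_zero, Complex.ofReal_eq_zero, Complex.I_ne_zero, or_false, not_or]
    exact ⟨⟨by norm_num, Real.pi_ne_zero⟩, hj'⟩
  have hbj : ∀ R : ℝ, 0 < R → ‖∫ t in Set.Icc (-(R / 2)) (R / 2),
      Complex.exp (2 * Real.pi * Complex.I * (l j * t))‖ ≤ 2 / ‖c‖ := by
    intro R hR
    rw [integral_Icc_eq_integral_Ioc, ← intervalIntegral.integral_of_le (by linarith)]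
    have : ∀ t : ℝ, Complex.exp (2 * Real.pi * Complex.I * (l j * t)) = Complex.exp (c * t) := by
      intro t; congr 1; simp only [c]; ring
    simp only [this]
    rw [integral_exp_mul_complex hc, norm_div]
    gcongr
    refine (norm_sub_le _ _).trans ?_
    rw [← this, ← this, hn, hn]; norm_num
  rw [tendsto_zero_iff_norm_tendsto_zero]
  refine squeeze_zero' (g := fun R : ℝ => 2 / ‖c‖ * R⁻¹)
    (Eventually.of_forall fun _ => norm_nonneg _) ?_
    (by simpa using tendsto_inv_atTop_zero.const_mul (2 / ‖c‖))
  filter_upwards [eventually_gt_atTop 0] with R hR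
  rw [cubeAvg, norm_smul, key, norm_prod, ← Finset.mul_prod_erase _ _ (Finset.mem_univ j),
    Real.norm_of_nonneg (by positivity)]
  have hprod : ∏ i ∈ Finset.univ.erase j, ‖∫ t in Set.Icc (-(R / 2)) (R / 2),
      Complex.exp (2 * Real.pi * Complex.I * (l i * t))‖ ≤ R ^ (n - 1) := by
    refine (Finset.prod_le_prod (fun _ _ => norm_nonneg _) fun i _ => hb R hR i).trans ?_
    rw [Finset.prod_const, Finset.card_erase_of_mem (Finset.mem_univ j), Finset.card_univ,
      Fintype.card_fin]
  have hn1 : n = (n - 1) + 1 := by have := j.2; omega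
  calc (R ^ n)⁻¹ * (_ * _) ≤ (R ^ n)⁻¹ * (2 / ‖c‖ * R ^ (n - 1)) := by
        gcongr
        exact hbj R hR
    _ = 2 / ‖c‖ * R⁻¹ := by
        conv_lhs => rw [hn1]
        rw [pow_succ, Nat.add_sub_cancel]
        field_simp

theorem norm_cubeAvg_le {n : ℕ} (f : (Fin n → ℝ) →ᵇ ℂ) {R : ℝ} (hR : 0 < R) :
    ‖cubeAvg n f R‖ ≤ ‖f‖ := by
  have hv : volume (cube n R) < ∞ := by rw [volume_cube n hR]; exact ENNReal.ofReal_lt_top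
  rw [cubeAvg, norm_smul, Real.norm_of_nonneg (by positivity)]
  have h := norm_setIntegral_le_of_norm_le_const (f := f) hv (C := ‖f‖)
    (fun x _ => f.norm_coe_le_norm x)
  rw [Measure.real, volume_cube n hR, ENNReal.toReal_ofReal (by positivity)] at h
  calc (R ^ n)⁻¹ * _ ≤ (R ^ n)⁻¹ * (‖f‖ * R ^ n) := by gcongr
    _ = ‖f‖ := by field_simp

theorem integrableOn_cube {n : ℕ} (f : (Fin n → ℝ) →ᵇ ℂ) (R : ℝ) : IntegrableOn f (cube n R) :=
  f.continuous.continuousOn.integrableOn_compact (isCompact_cube n R)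

theorem integrable_gelfand {n : ℕ} (f : AP n) : Integrable (gelfand n f) (Bohr.haar n) :=
  (gelfand n f).continuous.integrable_of_hasCompactSupport
    (HasCompactSupport.of_compactSpace _)

/-- The Haar measure represents the mean value functional. -/
theorem tendsto_cubeAvg {n : ℕ} (f : AP n) :
    Tendsto (cubeAvg n f.1) atTop (𝓝 (∫ p, gelfand n f p ∂Bohr.haar n)) := by
  let S : Submodule ℂ (AP n) :=
    { carrier := {f | Tendsto (cubeAvg n f.1) atTop (𝓝 (∫ p, gelfand n f p ∂Bohr.haar n))}
      add_mem' := by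
        intro f g hf hg
        have h1 : cubeAvg n (f + g).1 = fun R => cubeAvg n f.1 R + cubeAvg n g.1 R := by
          ext R
          rw [cubeAvg, cubeAvg, cubeAvg, ← smul_add,
            ← integral_add (integrableOn_cube f.1 R) (integrableOn_cube g.1 R)]
          rfl
        change Tendsto _ _ _
        rw [h1]
        simp only [map_add, ContinuousMap.add_apply]
        rw [integral_add (integrable_gelfand f) (integrable_gelfand g)]
        exact Tendsto.add hf hg
      zero_mem' := by
        have h1 : cubeAvg n (0 : AP n).1 = fun _ => 0 := by
          ext R; simp [cubeAvg]
        change Tendsto _ _ _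
        rw [h1]; simp
      smul_mem' := by
        intro c f hf
        have h1 : cubeAvg n (c • f).1 = fun R => c * cubeAvg n f.1 R := by
          ext R
          rw [cubeAvg, cubeAvg, ← smul_eq_mul c, smul_comm c, ← integral_smul c]; rfl
        change Tendsto _ _ _
        rw [h1]
        simp only [map_smul, ContinuousMap.smul_apply, smul_eq_mul]
        rw [integral_const_mul]
        exact Tendsto.const_mul c hf }
  refine AP_induction S ?_ (fun l => ?_) f
  · rw [← isSeqClosed_iff_isClosed]
    intro u f hu hf
    change Tendsto _ _ _
    rw [Metric.tendsto_atTop]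
    intro ε hε
    obtain ⟨k, hk⟩ := (Metric.tendsto_atTop.1 hf (ε / 3) (by positivity))
    have hk := hk k le_rfl
    rw [dist_comm, dist_eq_norm] at hk
    obtain ⟨N, hN⟩ := Metric.tendsto_atTop.1 (hu k) (ε / 3) (by positivity)
    refine ⟨max N 1, fun R hR => ?_⟩
    have hR0 : 0 < R := lt_of_lt_of_le one_pos ((le_max_right _ _).trans hR)
    have h1 : dist (cubeAvg n f.1 R) (cubeAvg n (u k).1 R) < ε / 3 := by
      rw [dist_eq_norm]
      refine lt_of_le_of_lt ?_ hk
      have : cubeAvg n f.1 R - cubeAvg n (u k).1 R = cubeAvg n (f - u k).1 R := by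
        rw [cubeAvg, cubeAvg, cubeAvg, ← smul_sub,
          ← integral_sub (integrableOn_cube f.1 R) (integrableOn_cube (u k).1 R)]
        rfl
      rw [this]
      exact norm_cubeAvg_le _ hR0
    have h2 := hN R ((le_max_left _ _).trans hR)
    have h3 : dist (∫ p, gelfand n (u k) p ∂Bohr.haar n) (∫ p, gelfand n f p ∂Bohr.haar n)
        < ε / 3 := by
      rw [dist_comm, dist_eq_norm]
      refine lt_of_le_of_lt ?_ hk
      rw [← integral_sub (integrable_gelfand f) (integrable_gelfand (u k))]
      refine (norm_integral_le_of_norm_le_const (C := ‖f - u k‖)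
        (Eventually.of_forall fun p => ?_)).trans (by simp)
      rw [← ContinuousMap.sub_apply, ← map_sub]
      exact p.norm_hom_le _
    calc dist _ _ ≤ _ + _ + _ := dist_triangle4 _ _ _ _
      _ < ε / 3 + ε / 3 + ε / 3 := by gcongr
      _ = ε := by ring
  · change Tendsto (cubeAvg n (expo n l)) atTop _
    by_cases hl : l = 0
    · subst hl
      have h1 : expAP n 0 = 1 := Subtype.ext (expo_zero n)
      rw [h1, map_one, expo_zero]
      simp only [ContinuousMap.one_apply, integral_const, probReal_univ, one_smul]
      refine tendsto_const_nhds.congr' ?_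
      filter_upwards [eventually_gt_atTop 0] with R hR
      rw [cubeAvg]
      simp only [BoundedContinuousFunction.coe_one, Pi.one_apply, integral_const]
      rw [Measure.real, Measure.restrict_apply_univ, volume_cube n hR,
        ENNReal.toReal_ofReal (by positivity), smul_smul, inv_mul_cancel₀ (by positivity), one_smul]
    · rw [integral_expAP hl]
      exact tendsto_cubeAvg_expo hl

/-- The Gelfand transform preserves the mean `L¹`-norm on `AP(ℝⁿ)`. -/
theorem norm_gelfandAP {n : ℕ} (f : AP n) : ‖gelfandAP n f‖ = ‖apToBes n f‖ := by
  let g : C(Bohr n, ℂ) := ⟨fun p => (‖gelfand n f p‖ : ℂ), by fun_prop⟩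
  obtain ⟨w, hw⟩ : ∃ w, gelfand n w = g := (gelfandTransform_bijective (AP n)).2 g
  have hwx : ∀ x, w.1 x = (‖f.1 x‖ : ℂ) := fun x => by
    rw [← gelfand_emb, hw, ← gelfand_emb f]; rfl
  have h := tendsto_cubeAvg w
  rw [hw] at h
  have hI : ∫ p, g p ∂Bohr.haar n = ((∫ p, ‖gelfand n f p‖ ∂Bohr.haar n : ℝ) : ℂ) :=
    integral_ofReal
  have hC : ∀ R, cubeAvg n w.1 R = (((R ^ n)⁻¹ * ∫ x in cube n R, ‖f.1 x‖ : ℝ) : ℂ) := fun R => by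
    rw [cubeAvg]
    simp only [hwx]
    rw [integral_complex_ofReal, Complex.real_smul, ← Complex.ofReal_mul]
  rw [hI] at h
  have h' : Tendsto (fun R : ℝ => (R ^ n)⁻¹ * ∫ x in cube n R, ‖f.1 x‖) atTop
      (𝓝 (∫ p, ‖gelfand n f p‖ ∂Bohr.haar n)) := by
    have := (Complex.continuous_re.tendsto _).comp h
    simpa only [Function.comp_def, hC, Complex.ofReal_re] using this
  have hm : meanNorm n f.1 = ENNReal.ofReal (∫ p, ‖gelfand n f p‖ ∂Bohr.haar n) := by
    refine Tendsto.limsup_eq ?_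
    refine ((ENNReal.continuous_ofReal.tendsto _).comp h').congr' ?_
    filter_upwards [eventually_gt_atTop 0] with R hR
    simp only [Function.comp_apply]
    rw [ENNReal.ofReal_mul (by positivity),
      ofReal_integral_norm_eq_lintegral_enorm (integrableOn_cube f.1 R)]
  rw [norm_apToBes, hm, ENNReal.toReal_ofReal (integral_nonneg fun _ => norm_nonneg _),
    L1.norm_eq_integral_norm]
  refine integral_congr_ae ?_
  filter_upwards [ContinuousMap.coeFn_toLp (p := 1) (𝕜 := ℂ) (Bohr.haar n) (gelfand n f)] with p hp
  exact congrArg norm hp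

/-- The Gelfand transform `u ↦ û` of the Besicovitch space: the continuous extension of the Gelfand
transform of `AP(ℝⁿ)` to a linear isometry into `L¹(𝔅ₙ, m)`. -/
def gelfandBes (n : ℕ) : besicovitch n →ₗᵢ[ℂ] Lp ℂ 1 (Bohr.haar n) where
  toLinearMap := ((gelfandAP n).extendOfNorm (apToBes n)).toLinearMap
  norm_map' u := by
    refine (denseRange_apToBes n).induction_on
      (p := fun u => ‖(gelfandAP n).extendOfNorm (apToBes n) u‖ = ‖u‖) u ?_ ?_
    · exact isClosed_eq (by fun_prop) continuous_norm
    · intro f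
      rw [LinearMap.extendOfNorm_eq (denseRange_apToBes n)
        ⟨1, fun f => by rw [one_mul, norm_gelfandAP]⟩, norm_gelfandAP]

theorem gelfandBes_apToBes {n : ℕ} (f : AP n) : gelfandBes n (apToBes n f) = gelfandAP n f :=
  LinearMap.extendOfNorm_eq (denseRange_apToBes n) ⟨1, fun f => by rw [one_mul, norm_gelfandAP]⟩ f

end

open scoped NNReal

/-! The theorem follows from one nonlinear map, the radial retraction T of ℂ onto the closed disc of
radius M. A number z satisfies |z| ≤ M exactly when T z = z, so a sup-norm bound on a function
becomes an equation, up to null sets. Equations, unlike bounds, pass between ℝⁿ and the Bohr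
compactification through an injective map that commutes with T.

Since T is Lipschitz, composition with it is Lipschitz for N₁ and for the L¹ norm on 𝔅ₙ. It
therefore descends to B¹/B¹₀ (`truncQuot`). On AP(ℝⁿ) it commutes with the Gelfand transform,
because that transform is onto C(𝔅ₙ) and restricts to f on the image of ℝⁿ (`exists_comp_AP`).
Density and continuity extend both the stability of the space and the commutation to 𝔅¹
(`exists_gelfandBes_truncQuot`). As u ↦ û is an isometry, ‖û‖_∞ ≤ M if and only if T u = u as
classes (`eLpNorm_gelfandBes_le_iff`).

A representative bounded by M is fixed by T almost everywhere, so û is bounded by M. Conversely, if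
û is bounded by M and w is any representative of u, then T ∘ w is a representative bounded by M.
Hence the infimum is attained when û is bounded. T multiplies by a real scalar, so it keeps
real-valued functions real, which settles the last assertion. -/

/-! ### Radial truncation in the complex plane -/

/-- The radial retraction of `ℂ` onto the closed disc of radius `M`. -/
noncomputable def radialTrunc (M : ℝ≥0) (z : ℂ) : ℂ := ((M : ℝ) / max (M : ℝ) ‖z‖) • z

theorem radialTrunc_zero (M : ℝ≥0) : radialTrunc M 0 = 0 := smul_zero _

/-- Truncation is multiplication by a real number; this is all that the real-valued case needs
beyond the general argument. -/
theorem radialTrunc_im {M : ℝ≥0} {z : ℂ} (h : z.im = 0) : (radialTrunc M z).im = 0 := by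
  rw [radialTrunc, Complex.smul_im, h, smul_zero]

theorem norm_radialTrunc_le (M : ℝ≥0) (z : ℂ) : ‖radialTrunc M z‖ ≤ M := by
  rw [radialTrunc, norm_smul, Real.norm_of_nonneg (by positivity), div_mul_eq_mul_div, mul_div_assoc]
  exact mul_le_of_le_one_right M.2 (div_le_one_of_le₀ (le_max_right _ _) (by positivity))

theorem radialTrunc_eq_self {M : ℝ≥0} {z : ℂ} (h : ‖z‖ ≤ M) : radialTrunc M z = z := by
  rw [radialTrunc, max_eq_left h]
  -- For M = 0 the quotient is 0 / 0 = 0 rather than 1, but then z = 0.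
  rcases eq_or_ne (M : ℝ) 0 with h0 | h0
  · rw [norm_le_zero_iff.1 (h.trans h0.le), smul_zero]
  · rw [div_self h0, one_smul]

/-- The disc is the fixed-point set of the retraction; this turns a norm bound into an equation. -/
theorem radialTrunc_eq_self_iff {M : ℝ≥0} {z : ℂ} : radialTrunc M z = z ↔ ‖z‖ ≤ M :=
  ⟨fun h => h ▸ norm_radialTrunc_le M z, radialTrunc_eq_self⟩

/-- The constant 2 comes from a plain triangle inequality and is not optimal; only some Lipschitz
bound matters later, since it serves just for continuity and passage to the quotient. -/
theorem lipschitzWith_radialTrunc (M : ℝ≥0) : LipschitzWith 2 (radialTrunc M) := by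
  refine LipschitzWith.of_dist_le_mul fun z w => ?_
  rw [dist_eq_norm, dist_eq_norm, NNReal.coe_ofNat]
  rcases eq_zero_or_pos M with h0 | h0
  · simp [radialTrunc, h0]
  have hM : (0 : ℝ) < M := h0
  simp only [radialTrunc]
  have hmz : 0 < max (M : ℝ) ‖z‖ := lt_max_of_lt_left hM
  have hmw : 0 < max (M : ℝ) ‖w‖ := lt_max_of_lt_left hM
  have hd : |max (M : ℝ) ‖w‖ - max (M : ℝ) ‖z‖| ≤ ‖z - w‖ := by
    refine (abs_max_sub_max_le_max _ _ _ _).trans ?_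
    rw [sub_self, abs_zero, max_eq_right (abs_nonneg _), norm_sub_rev]
    exact abs_norm_sub_norm_le w z
  have ha : (M : ℝ) / max (M : ℝ) ‖z‖ ≤ 1 := div_le_one_of_le₀ (le_max_left _ _) hmz.le
  have hb : ‖w‖ / max (M : ℝ) ‖w‖ ≤ 1 := div_le_one_of_le₀ (le_max_right _ _) hmw.le
  generalize max (M : ℝ) ‖z‖ = s at *
  generalize max (M : ℝ) ‖w‖ = t at *
  -- Here s and t stand for max(M, ‖z‖) and max(M, ‖w‖). Each of the two terms is at most ‖z - w‖:
  -- the first because M ≤ s, the second because |t - s| ≤ ‖z - w‖ and ‖w‖ ≤ t.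
  have hsplit : ((M : ℝ) / s) • z - ((M : ℝ) / t) • w =
      ((M : ℝ) / s) • (z - w) + ((M : ℝ) / s - (M : ℝ) / t) • w := by
    rw [smul_sub, sub_smul]; abel
  have hst : ((M : ℝ) / s - (M : ℝ) / t) = (M : ℝ) / s * ((t - s) / t) := by
    field_simp
  rw [hsplit, two_mul]
  refine (norm_add_le _ _).trans (add_le_add ?_ ?_)
  · rw [norm_smul, Real.norm_of_nonneg (by positivity)]
    exact mul_le_of_le_one_left (norm_nonneg _) ha
  · rw [norm_smul, hst, Real.norm_eq_abs, abs_mul, abs_div (t - s), abs_of_pos hmw,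
      abs_of_nonneg (show 0 ≤ (M : ℝ) / s by positivity)]
    calc (M : ℝ) / s * (|t - s| / t) * ‖w‖ = (M : ℝ) / s * (|t - s| * (‖w‖ / t)) := by ring
      _ ≤ 1 * (‖z - w‖ * 1) := by gcongr
      _ = ‖z - w‖ := by ring

theorem continuous_radialTrunc (M : ℝ≥0) : Continuous (radialTrunc M) :=
  (lipschitzWith_radialTrunc M).continuous

theorem enorm_radialTrunc_sub_le (M : ℝ≥0) (z w : ℂ) :
    ‖radialTrunc M z - radialTrunc M w‖ₑ ≤ 2 * ‖z - w‖ₑ := by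
  simpa only [edist_eq_enorm_sub, ENNReal.coe_ofNat] using lipschitzWith_radialTrunc M z w

/-! ### Truncation on `B1` and on its quotient -/

theorem meanNorm_mono {n : ℕ} {u v : (Fin n → ℝ) → ℂ} (h : ∀ᵐ x, ‖u x‖ₑ ≤ ‖v x‖ₑ) :
    meanNorm n u ≤ meanNorm n v := by
  refine limsup_le_limsup (Eventually.of_forall fun R => ?_)
  exact mul_le_mul_right (lintegral_mono_ae (ae_restrict_of_ae h)) _

/-- Radial truncation of the functions in `B¹(ℝⁿ)`. -/
noncomputable def truncB1 {n : ℕ} (M : ℝ≥0) (v : B1 n) : B1 n :=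
  ⟨fun x => radialTrunc M (v x), by
    constructor
    · refine (locallyIntegrable_const (M : ℝ)).mono
        ((continuous_radialTrunc M).comp_aestronglyMeasurable
          v.locallyIntegrable.aestronglyMeasurable) (Eventually.of_forall fun x => ?_)
      exact (norm_radialTrunc_le M (v x)).trans (le_abs_self _)
    · refine (meanNorm_le_of_bound n (M := M) fun x => ?_).trans_lt ENNReal.coe_lt_top
      exact enorm_le_coe.2 (norm_radialTrunc_le M (v x))⟩

theorem truncB1_apply {n : ℕ} (M : ℝ≥0) (v : B1 n) (x : Fin n → ℝ) :
    truncB1 M v x = radialTrunc M (v x) := rfl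

theorem eLpNorm_truncB1_le {n : ℕ} (M : ℝ≥0) (v : B1 n) :
    eLpNorm (truncB1 M v : (Fin n → ℝ) → ℂ) ∞ volume ≤ M := by
  rw [eLpNorm_exponent_top]
  exact eLpNormEssSup_le_of_ae_nnnorm_bound
    (Eventually.of_forall fun x => norm_radialTrunc_le M (v x))

theorem memLp_truncB1 {n : ℕ} (M : ℝ≥0) (v : B1 n) :
    MemLp (truncB1 M v : (Fin n → ℝ) → ℂ) ∞ volume :=
  ⟨(truncB1 M v).locallyIntegrable.aestronglyMeasurable,
    (eLpNorm_truncB1_le M v).trans_lt ENNReal.coe_lt_top⟩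

theorem lipschitzWith_truncB1 {n : ℕ} (M : ℝ≥0) :
    LipschitzWith 2 (truncB1 M : B1 n → B1 n) := by
  refine LipschitzWith.of_dist_le_mul fun u v => ?_
  rw [dist_eq_norm, dist_eq_norm, B1.norm_def, B1.norm_def]
  -- The Lipschitz factor is written as a scalar multiple of u - v, so that homogeneity of N₁
  -- extracts it.
  have h : meanNorm n (truncB1 M u - truncB1 M v).1 ≤ meanNorm n ((2 : ℂ) • (u - v).1) :=
    meanNorm_mono (Eventually.of_forall fun x => by
      rw [Pi.smul_apply, enorm_smul]
      have h2 : ‖(2 : ℂ)‖ₑ = 2 := by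
        rw [← ofReal_norm, Complex.norm_ofNat, ENNReal.ofReal_ofNat]
      rw [h2]
      exact enorm_radialTrunc_sub_le M (u x) (v x))
  rw [meanNorm_smul] at h
  have h2 := ENNReal.toReal_mono (ENNReal.mul_ne_top enorm_ne_top (u - v).2.2.ne) h
  rwa [ENNReal.toReal_mul, toReal_enorm, Complex.norm_ofNat] at h2

theorem truncB1_cls_eq {n : ℕ} {M : ℝ≥0} {v : B1 n} (h : ∀ᵐ x, ‖v x‖ ≤ M) :
    B1.cls (truncB1 M v) = B1.cls v := by
  rw [B1.cls_eq_iff, ← nonpos_iff_eq_zero, ← meanNorm_zero n]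
  refine meanNorm_mono ?_
  filter_upwards [h] with x hx
  rw [truncB1_apply, radialTrunc_eq_self hx, sub_self, Pi.zero_apply]

/-- Radial truncation on the quotient `B¹(ℝⁿ) / B¹₀(ℝⁿ)`. -/
noncomputable def truncQuot {n : ℕ} (M : ℝ≥0) : B1Quot n → B1Quot n :=
  SeparationQuotient.lift (fun v => B1.cls (truncB1 M v)) fun _ _ h =>
    -- Functions with N₁(u - v) = 0 are inseparable; a continuous map keeps them so, and inseparable
    -- points of the separated quotient coincide.
    (h.map (B1.cls.continuous.comp (lipschitzWith_truncB1 M).continuous)).eq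

theorem truncQuot_cls {n : ℕ} (M : ℝ≥0) (v : B1 n) :
    truncQuot M (B1.cls v) = B1.cls (truncB1 M v) := rfl

theorem continuous_truncQuot {n : ℕ} (M : ℝ≥0) :
    Continuous (truncQuot M : B1Quot n → B1Quot n) :=
  SeparationQuotient.continuous_lift
    (B1.cls.continuous.comp (lipschitzWith_truncB1 M).continuous)

/-! ### Compatibility of truncation with the Gelfand transform -/

/-- `AP(ℝⁿ)` is stable under composition with continuous functions. -/
theorem exists_comp_AP {n : ℕ} {φ : ℂ → ℂ} (hφ : Continuous φ) (f : AP n) :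
    ∃ g : AP n, (∀ x, g.1 x = φ (f.1 x)) ∧ ∀ p, gelfand n g p = φ (gelfand n f p) := by
  -- Commutative Gelfand–Naimark: the continuous function φ ∘ f̂ on the spectrum is a Gelfand
  -- transform. Evaluating at the image of x in 𝔅ₙ then identifies g with φ ∘ f.
  obtain ⟨g, hg⟩ : ∃ g, gelfand n g = (⟨fun p => φ (gelfand n f p), by fun_prop⟩ : C(Bohr n, ℂ)) :=
    (gelfandTransform_bijective (AP n)).2 (⟨fun p => φ (gelfand n f p), by fun_prop⟩ : C(Bohr n, ℂ))
  have hp : ∀ p, gelfand n g p = φ (gelfand n f p) := fun p => by rw [hg]; rfl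
  exact ⟨g, fun x => by rw [← gelfand_emb, hp, gelfand_emb], hp⟩

/-- Radial truncation preserves the Besicovitch space and commutes with the Gelfand transform. -/
theorem exists_gelfandBes_truncQuot {n : ℕ} (M : ℝ≥0) (u : besicovitch n) :
    ∃ u' : besicovitch n, (u' : B1Quot n) = truncQuot M (u : B1Quot n) ∧
      gelfandBes n u' =
        (lipschitzWith_radialTrunc M).compLp (radialTrunc_zero M) (gelfandBes n u) := by
  -- On the dense subspace both claims are pointwise identities, with φ the truncation.
  have hAP : ∀ f : AP n, ∃ g : AP n,
      (apToBes n g : B1Quot n) = truncQuot M (apToBes n f : B1Quot n) ∧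
      gelfandAP n g =
        (lipschitzWith_radialTrunc M).compLp (radialTrunc_zero M) (gelfandAP n f) := by
    intro f
    obtain ⟨g, hg, hgp⟩ := exists_comp_AP (continuous_radialTrunc M) f
    refine ⟨g, ?_, ?_⟩
    · change B1.cls (toB1 n g.1) = B1.cls (truncB1 M (toB1 n f.1))
      congr 1
      exact Subtype.ext (funext hg)
    · refine Lp.ext ?_
      filter_upwards [ContinuousMap.coeFn_toLp (p := 1) (𝕜 := ℂ) (Bohr.haar n) (gelfand n g),
        ContinuousMap.coeFn_toLp (p := 1) (𝕜 := ℂ) (Bohr.haar n) (gelfand n f),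
        (lipschitzWith_radialTrunc M).coeFn_compLp (radialTrunc_zero M) (gelfandAP n f)]
        with p h1 h2 h3
      rw [h3]
      refine h1.trans ((hgp p).trans ?_)
      exact congrArg (radialTrunc M) h2.symm
  -- The Besicovitch space is closed and truncation is continuous, so membership is a closed
  -- condition and holds everywhere once it holds on AP(ℝⁿ).
  have hmem : ∀ v : besicovitch n, truncQuot M (v : B1Quot n) ∈ besicovitch n := fun v =>
    (denseRange_apToBes n).induction_on
      (p := fun v : besicovitch n => truncQuot M (v : B1Quot n) ∈ besicovitch n) v
      ((Submodule.isClosed_topologicalClosure _).preimage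
        ((continuous_truncQuot M).comp continuous_subtype_val))
      fun f => by
        obtain ⟨g, hg, -⟩ := hAP f
        exact hg ▸ (apToBes n g).2
  refine ⟨⟨_, hmem u⟩, rfl, ?_⟩
  refine (denseRange_apToBes n).induction_on
    (p := fun v : besicovitch n => gelfandBes n ⟨truncQuot M (v : B1Quot n), hmem v⟩ =
      (lipschitzWith_radialTrunc M).compLp (radialTrunc_zero M) (gelfandBes n v)) u ?_ ?_
  · refine isClosed_eq ((gelfandBes n).continuous.comp ?_)
      (((lipschitzWith_radialTrunc M).continuous_compLp (radialTrunc_zero M)).comp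
        (gelfandBes n).continuous)
    exact ((continuous_truncQuot M).comp continuous_subtype_val).subtype_mk _
  · intro f
    obtain ⟨g, hg, hg'⟩ := hAP f
    have : (⟨truncQuot M (apToBes n f : B1Quot n), hmem (apToBes n f)⟩ : besicovitch n) =
        apToBes n g := Subtype.ext hg.symm
    rw [this, gelfandBes_apToBes, gelfandBes_apToBes, hg']

/-! ### Sup-norm bounds as fixed-point equations, and the conclusion -/

theorem eLpNorm_top_le_iff {α E : Type*} [MeasurableSpace α] {μ : Measure α} [NormedAddCommGroup E]
    {f : α → E} {M : ℝ≥0} : eLpNorm f ∞ μ ≤ M ↔ ∀ᵐ x ∂μ, ‖f x‖ ≤ M := by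
  rw [eLpNorm_exponent_top]
  refine ⟨fun h => ?_, fun h => eLpNormEssSup_le_of_ae_nnnorm_bound h⟩
  filter_upwards [ae_le_eLpNormEssSup (f := f) (μ := μ)] with x hx
  exact enorm_le_coe.1 (hx.trans h)

/-- The Gelfand transform of `u` is bounded by `M` exactly when `u` is fixed by truncation. -/
theorem eLpNorm_gelfandBes_le_iff {n : ℕ} (M : ℝ≥0) (u : besicovitch n) :
    eLpNorm (gelfandBes n u : Bohr n → ℂ) ∞ (Bohr.haar n) ≤ M ↔
      truncQuot M (u : B1Quot n) = u := by
  obtain ⟨u', hu', hg⟩ := exists_gelfandBes_truncQuot M u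
  have hc := (lipschitzWith_radialTrunc M).coeFn_compLp (radialTrunc_zero M) (gelfandBes n u)
  -- Injectivity of the isometry moves the fixed-point equation from B¹/B¹₀ to L¹(𝔅ₙ), where it can
  -- be read almost everywhere.
  rw [eLpNorm_top_le_iff, ← hu', ← Subtype.ext_iff, ← (gelfandBes n).injective.eq_iff, hg, Lp.ext_iff]
  constructor
  · intro h
    filter_upwards [hc, h] with p h1 h2
    rw [h1, Function.comp_apply, radialTrunc_eq_self h2]
  · intro h
    filter_upwards [hc, h] with p h1 h2
    rw [h1] at h2
    exact radialTrunc_eq_self_iff.1 h2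

/-- Truncation exists only for finite radii, so norms that may be infinite are compared through
their finite upper bounds. -/
theorem ennreal_le_of_forall_nnreal_ge {a b : ℝ≥0∞} (h : ∀ M : ℝ≥0, b ≤ M → a ≤ M) : a ≤ b := by
  induction b with
  | top => exact le_top
  | coe b => exact h b le_rfl

/-- Both assertions of the theorem, for representatives in a class that is stable under
truncation. -/
theorem memLp_gelfandBes_iff_and_eLpNorm_eq {n : ℕ} (u : besicovitch n) (P : B1 n → Prop)
    (hP : ∀ M v, P v → P (truncB1 M v)) (hw : ∃ w : B1 n, B1.cls w = (u : B1Quot n) ∧ P w) :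
    ((∃ v : B1 n, B1.cls v = (u : B1Quot n) ∧ P v ∧ MemLp (v : (Fin n → ℝ) → ℂ) ∞ volume) ↔
      MemLp (gelfandBes n u : Bohr n → ℂ) ∞ (Bohr.haar n)) ∧
    eLpNorm (gelfandBes n u : Bohr n → ℂ) ∞ (Bohr.haar n) =
      ⨅ v ∈ {v : B1 n | B1.cls v = (u : B1Quot n) ∧ P v ∧
        MemLp (v : (Fin n → ℝ) → ℂ) ∞ volume}, eLpNorm (v : (Fin n → ℝ) → ℂ) ∞ volume := by
  obtain ⟨w, hwu, hwP⟩ := hw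
  -- A representative bounded by M equals its truncation almost everywhere, so its class is fixed.
  -- An infinite norm on the right needs no argument.
  have hle : ∀ v : B1 n, B1.cls v = (u : B1Quot n) →
      eLpNorm (gelfandBes n u : Bohr n → ℂ) ∞ (Bohr.haar n) ≤
        eLpNorm (v : (Fin n → ℝ) → ℂ) ∞ volume := by
    intro v hv
    refine ennreal_le_of_forall_nnreal_ge fun M hM => ?_
    rw [eLpNorm_gelfandBes_le_iff, ← hv, truncQuot_cls, truncB1_cls_eq (eLpNorm_top_le_iff.1 hM)]
  -- The class of u is fixed, so truncating any representative w, even an unbounded one, gives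
  -- another representative.
  have hex : ∀ M : ℝ≥0, eLpNorm (gelfandBes n u : Bohr n → ℂ) ∞ (Bohr.haar n) ≤ M →
      B1.cls (truncB1 M w) = (u : B1Quot n) := fun M h => by
    rw [← truncQuot_cls, hwu]
    exact (eLpNorm_gelfandBes_le_iff M u).1 h
  refine ⟨⟨fun ⟨v, hv, _, hvL⟩ => ⟨(Lp.aestronglyMeasurable _), (hle v hv).trans_lt hvL.2⟩,
    fun h => ?_⟩, le_antisymm (le_iInf₂ fun v hv => hle v hv.1) ?_⟩
  -- M is ‖û‖_∞ itself, so this truncation attains the infimum.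
  · obtain ⟨M, hM⟩ := WithTop.ne_top_iff_exists.1 h.2.ne
    exact ⟨truncB1 M w, hex M hM.ge, hP M w hwP, memLp_truncB1 M w⟩
  -- If û is unbounded there is no such M and nothing is left to prove.
  · refine ennreal_le_of_forall_nnreal_ge fun M hM => ?_
    exact (iInf₂_le (truncB1 M w) ⟨hex M hM, hP M w hwP, memLp_truncB1 M w⟩).trans
      (eLpNorm_truncB1_le M w)

theorem lemma1 (n : ℕ) (u : besicovitch n) :
    ((∃ v : B1 n, B1.cls v = (u : B1Quot n) ∧ MemLp (v : (Fin n → ℝ) → ℂ) ∞ volume) ↔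
      MemLp (gelfandBes n u : Bohr n → ℂ) ∞ (Bohr.haar n)) ∧
    eLpNorm (gelfandBes n u : Bohr n → ℂ) ∞ (Bohr.haar n) =
      (⨅ v ∈ {v : B1 n | B1.cls v = (u : B1Quot n) ∧ MemLp (v : (Fin n → ℝ) → ℂ) ∞ volume},
        eLpNorm (v : (Fin n → ℝ) → ℂ) ∞ volume) ∧
    ((∃ w : B1 n, B1.cls w = (u : B1Quot n) ∧ ∀ x, (w x).im = 0) →
      ((∃ v : B1 n, B1.cls v = (u : B1Quot n) ∧ (∀ x, (v x).im = 0) ∧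
          MemLp (v : (Fin n → ℝ) → ℂ) ∞ volume) ↔
        MemLp (gelfandBes n u : Bohr n → ℂ) ∞ (Bohr.haar n)) ∧
      eLpNorm (gelfandBes n u : Bohr n → ℂ) ∞ (Bohr.haar n) =
        ⨅ v ∈ {v : B1 n | B1.cls v = (u : B1Quot n) ∧ (∀ x, (v x).im = 0) ∧
            MemLp (v : (Fin n → ℝ) → ℂ) ∞ volume},
          eLpNorm (v : (Fin n → ℝ) → ℂ) ∞ volume) := by
  -- Complex case: every class has a representative and no further condition is imposed. Only the
  -- real case needs a representative as a hypothesis.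
  obtain ⟨w, hw⟩ := SeparationQuotient.surjective_mk (u : B1Quot n)
  have h := memLp_gelfandBes_iff_and_eLpNorm_eq u (fun _ => True) (fun _ _ _ => trivial)
    ⟨w, hw, trivial⟩
  simp only [true_and] at h
  exact ⟨h.1, h.2, fun hr => memLp_gelfandBes_iff_and_eLpNorm_eq u (fun v => ∀ x, (v x).im = 0)
    (fun _ _ hv x => radialTrunc_im (hv x)) hr⟩
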